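/- Let $n\ge 0$ and let $M$ be a compact smooth Riemannian manifold of dimension $n$ (without boundary), regarded as a metric space $(M,d)$ with the Riemannian distance. (If $M$ is disconnected, $d$ may be any finite-valued metric that induces the manifold topology and agrees with the Riemannian distance on each connected component.) Let $r\ge 0$, and let the packing number $\mathrm{pack}_M(r)$ be the largest cardinality of a set $S\subseteq M$ such that $d(x,x')\ge r$ for all $x\ne x'$ in $S$. Let $\mathrm{AVR}^m(M;r)$ be the set of all probability measures $\sum_{i=0}^k\lambda_i\delta_{x_i}$ on $M$ with $k\ge 0$, $\lambda_i>0$, $\sum_i\lambda_i=1$, and $x_0,\dots,x_k$ distinct points with $d(x_i,x_j)\ge r$ for all $i\neq j$, equipped with the topology of the $1$-Wasserstein distance $$W_1(\mu,\nu)=\inf_\gamma\int_{M\times M} d(x,y)\,d\gamma(x,y),$$ the infimum being over all Borel measures $\gamma$ on $M\times M$ with marginals $\mu$ and $\nu$. The covering dimension of a topological space $X$ is said to be at most $m$ (where $m\in\mathbb{Z}$) if every open cover of $X$ has a refinement by open sets that covers $X$ and is such that no point of $X$ lies in more than $m+1$ sets of the refinement. If $r>0$, then $\mathrm{pack}_M(r)$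 is finite. Whenever $p=\mathrm{pack}_M(r)$ is finite, the covering dimension of $\mathrm{AVR}^m(M;r)$ is at most $(n+1)p-1$. -/

import Mathlib

open scoped Manifold ContDiff Bundle ENNReal NNReal

/-- A metric on a Riemannian manifold `M` is *Riemannian* if the distance of any two points lying
in a common connected component is the Riemannian distance, the infimum of the lengths of the
`C^1` paths joining them. (The Riemannian distance of points in different components is infinite;
there the metric is only required to take finite values, as every metric does.) For connected `M`
this is exactly Mathlib's `IsRiemannianManifold I M`, see `isRiemannianMetric_iff`. -/
def IsRiemannianMetric {E : Type*} [NormedAddCommGroup E] [NormedSpace ℝ E]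
    {H : Type*} [TopologicalSpace H] (I : ModelWithCorners ℝ E H)
    (M : Type*) [MetricSpace M] [ChartedSpace H M]
    [Bundle.RiemannianBundle (fun x : M ↦ TangentSpace I x)] : Prop :=
  ∀ x y : M, y ∈ connectedComponent x → edist x y = Manifold.riemannianEDist I x y

theorem isRiemannianMetric_iff {E : Type*} [NormedAddCommGroup E] [NormedSpace ℝ E]
    {H : Type*} [TopologicalSpace H] (I : ModelWithCorners ℝ E H)
    (M : Type*) [MetricSpace M] [ChartedSpace H M]
    [Bundle.RiemannianBundle (fun x : M ↦ TangentSpace I x)] [PreconnectedSpace M] :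
    IsRiemannianMetric I M ↔ IsRiemannianManifold I M := by
  constructor
  · intro h
    exact ⟨fun x y ↦ h x y (by simp [PreconnectedSpace.connectedComponent_eq_univ])⟩
  · intro h x y _
    exact h.out x y

/-- The `r`-packing number of a metric space `X`: the largest cardinality (in `ℕ∞`) of a set of
points any two distinct ones of which are at distance at least `r`. (Mathlib's
`Metric.packingNumber` uses the strict inequality, so it is a different number.) -/
noncomputable def packNumber (X : Type*) [MetricSpace X] (r : ℝ) : ℕ∞ :=
  ⨆ (S : Set X) (_ : S.Pairwise fun x y ↦ r ≤ dist x y), S.encard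

/-- The `1`-Wasserstein distance of two measures: the infimum over all transport plans `γ`, the
measures on `X × X` with marginals `μ` and `ν`, of the cost `∫ d(x, y) dγ`. The cost is taken in
`[0, ∞]`, so that there is no integrability convention. -/
noncomputable def wasserstein {X : Type*} [MetricSpace X] [MeasurableSpace X]
    (μ ν : MeasureTheory.Measure X) : ℝ≥0∞ :=
  ⨅ (γ : MeasureTheory.Measure (X × X)) (_ : γ.map Prod.fst = μ) (_ : γ.map Prod.snd = ν),
    ∫⁻ z, edist z.1 z.2 ∂γ

/-- The anti-Vietoris--Rips metric thickening of `X` at scale `r`: all measures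
`∑ x ∈ s, w x • δ_x` with `s` finite, weights `w x > 0` of sum `1`, and the distance of any two
distinct points of `s` at least `r`. -/
def AntiVRThickening (X : Type*) [MetricSpace X] [MeasurableSpace X] (r : ℝ) : Type _ :=
  {μ : MeasureTheory.Measure X // ∃ (s : Finset X) (w : X → ℝ≥0),
    (∀ x ∈ s, 0 < w x) ∧ ∑ x ∈ s, w x = 1 ∧ (∀ x ∈ s, ∀ y ∈ s, x ≠ y → r ≤ dist x y) ∧
    μ = ∑ x ∈ s, (w x : ℝ≥0∞) • MeasureTheory.Measure.dirac x}

/-- The topology of the `1`-Wasserstein distance: a set is open iff it contains, around each of its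
points, a ball of positive radius. -/
instance AntiVRThickening.instTopologicalSpace (X : Type*) [MetricSpace X] [MeasurableSpace X]
    (r : ℝ) : TopologicalSpace (AntiVRThickening X r) where
  IsOpen U := ∀ μ ∈ U, ∃ ε : ℝ≥0∞, 0 < ε ∧
    ∀ ν : AntiVRThickening X r, wasserstein μ.1 ν.1 < ε → ν ∈ U
  isOpen_univ _ _ := ⟨1, one_pos, fun _ _ ↦ Set.mem_univ _⟩
  isOpen_inter U V hU hV μ hμ := by
    obtain ⟨a, ha, hUa⟩ := hU μ hμ.1
    obtain ⟨b, hb, hVb⟩ := hV μ hμ.2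
    exact ⟨min a b, lt_min ha hb, fun ν hν ↦
      ⟨hUa ν (hν.trans_le (min_le_left a b)), hVb ν (hν.trans_le (min_le_right a b))⟩⟩
  isOpen_sUnion 𝒰 h μ hμ := by
    obtain ⟨U, hU, hμU⟩ := hμ
    obtain ⟨ε, hε, hball⟩ := h U hU μ hμU
    exact ⟨ε, hε, fun ν hν ↦ ⟨U, hU, hball ν hν⟩⟩

/-- The covering dimension of `X` is at most `m`: every open cover of `X` has an open refinement
covering `X` such that no point lies in more than `m + 1` of its sets. The bound `m` is an integer,
since the empty space has dimension `-1`. -/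
def CoveringDimLE (X : Type*) [TopologicalSpace X] (m : ℤ) : Prop :=
  ∀ 𝒰 : Set (Set X), (∀ U ∈ 𝒰, IsOpen U) → ⋃₀ 𝒰 = Set.univ →
    ∃ 𝒱 : Set (Set X), (∀ V ∈ 𝒱, IsOpen V) ∧ ⋃₀ 𝒱 = Set.univ ∧
      (∀ V ∈ 𝒱, ∃ U ∈ 𝒰, V ⊆ U) ∧
      ∀ x : X, {V ∈ 𝒱 | x ∈ V}.Finite ∧ ({V ∈ 𝒱 | x ∈ V}.ncard : ℤ) ≤ m + 1

/-! Every measure in the thickening has at most `p` atoms, so it is the image of a `p`-tuple of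
points with a probability vector of weights. These configurations form a compact set, of dimension
`n * p + (p - 1)` at most, and the map to measures is continuous and onto, so the thickening is
compact. The map is not injective (zero weights, coinciding points, permutations), so the dimension
bound is not pulled through it directly.

Instead, functions of measures that are `C^1` in points and weights are used. They form an algebra
that separates measures, because it contains the integrals of `C^1` functions. With `d = (n + 1) *
p`, any `d` of them map the thickening onto a compact subset of `ℝ^d` of Hausdorff dimension at most
`d - 1`, hence nowhere dense (`IsSmoothInCharts.dense_compl_range`).

By `coveringDimLE_of_separatesPoints` this forces covering dimension at most `d - 1`: a finite cover
by positivity sets of functions in the algebra is shifted by generic small constants, so that no `d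
+ 1` of the functions agree anywhere; the sets where a shifted function nearly attains the maximum
then overlap at most `d` at a time. -/

/-! ### Covering dimension from a separating algebra -/

open Set in
/-- A point of an open set is separated from the complement by a function of a point-separating
algebra, in the sense that the function is positive at the point and only inside the open set. -/
theorem exists_mem_subalgebra_pos_subset {X : Type*} [TopologicalSpace X] [CompactSpace X]
    [T2Space X] {A : Subalgebra ℝ C(X, ℝ)} (hA : A.SeparatesPoints) {U : Set X} (hU : IsOpen U)
    {x : X} (hx : x ∈ U) : ∃ φ ∈ A, 0 < φ x ∧ ∀ y, 0 < φ y → y ∈ U := by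
  obtain ⟨f, hf0, hf1, -⟩ := exists_continuous_zero_one_of_isClosed hU.isClosed_compl
    (isClosed_singleton (x := x)) (by simpa using hx)
  obtain ⟨g, hg⟩ := ContinuousMap.exists_mem_subalgebra_near_continuousMap_of_separatesPoints
    A hA f (1 / 3) (by norm_num)
  have hdist : ∀ y, |g.1 y - f y| < 1 / 3 := fun y ↦
    ((g.1 - f).norm_coe_le_norm y).trans_lt hg
  -- The Urysohn function is `1` at `x` and `0` off `U`; a Stone–Weierstrass approximation within `1
  -- / 3`, lowered by `1 / 3`, keeps the right signs.
  refine ⟨g.1 - algebraMap ℝ _ (1 / 3), A.sub_mem g.2 (A.algebraMap_mem _), ?_, fun y hy ↦ ?_⟩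
  · have h := hdist x
    rw [hf1 rfl, abs_lt] at h
    simp only [ContinuousMap.sub_apply, algebraMap_apply, smul_eq_mul, mul_one,
      Pi.one_apply] at h ⊢
    linarith
  · by_contra hyU
    have h := hdist y
    rw [hf0 hyU, abs_lt] at h
    simp only [ContinuousMap.sub_apply, algebraMap_apply, smul_eq_mul, mul_one,
      Pi.zero_apply] at h hy
    linarith

open Set in
/-- If the ranges of all `d`-tuples of functions in a subalgebra are nowhere dense, then after
generic small shifts no `d + 1` functions of a finite family in it agree at a point. -/
theorem exists_generic_shift {X : Type*} [TopologicalSpace X] [CompactSpace X]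
    (A : Subalgebra ℝ C(X, ℝ)) {d : ℕ}
    (hd : ∀ F : Fin d → C(X, ℝ), (∀ k, F k ∈ A) → Dense (range fun x k ↦ F k x)ᶜ)
    {ι : Type*} [Finite ι] (φ : ι → C(X, ℝ)) (hφ : ∀ i, φ i ∈ A) {η : ℝ} (hη : 0 < η) :
    ∃ c : ι → ℝ, (∀ i, |c i| < η) ∧ ∀ j : Fin (d + 1) → ι, Function.Injective j → ∀ x,
      ∃ k : Fin d, φ (j k.succ) x - φ (j 0) x ≠ c (j k.succ) - c (j 0) := by
  classical
  have := Fintype.ofFinite ι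
  let D : (Fin (d + 1) → ι) → (ι → ℝ) →L[ℝ] (Fin d → ℝ) := fun j ↦
    ContinuousLinearMap.pi fun k : Fin d ↦
      ContinuousLinearMap.proj (R := ℝ) (φ := fun _ : ι ↦ ℝ) (j k.succ) -
        ContinuousLinearMap.proj (R := ℝ) (φ := fun _ : ι ↦ ℝ) (j 0)
  have hD : ∀ j c (k : Fin d), D j c k = c (j k.succ) - c (j 0) := fun _ _ _ ↦ rfl
  let G : (Fin (d + 1) → ι) → X → Fin d → ℝ := fun j x (k : Fin d) ↦ (φ (j k.succ) - φ (j 0)) x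
  have hG : ∀ j, IsClosed (range (G j)) := fun j ↦
    (isCompact_range (continuous_pi fun k : Fin d ↦ (φ (j k.succ) - φ (j 0)).continuous)).isClosed
  -- A shift is bad for `j` exactly when `D j c` lies in the range of `G j`. Each good set is open,
  -- and dense since `D j` is an open map; there are finitely many `j`.
  have hdense : Dense (⋂ j : {j : Fin (d + 1) → ι // Function.Injective j},
      D j.1 ⁻¹' (range (G j.1))ᶜ) := by
    refine dense_iInter_of_isOpen
      (fun j ↦ (hG j.1).isOpen_compl.preimage (D j.1).continuous) fun ⟨j, hj⟩ ↦ ?_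
    refine Dense.preimage (hd _ fun k ↦ A.sub_mem (hφ _) (hφ _)) ?_
    refine (D j).isOpenMap fun v ↦
      ⟨Function.extend j (Fin.cons 0 v : Fin (d + 1) → ℝ) 0, ?_⟩
    ext k
    simp [hD, hj.extend_apply]
  obtain ⟨c, hc, hcη⟩ := hdense.exists_dist_lt (0 : ι → ℝ) hη
  refine ⟨c, fun i ↦ ?_, fun j hj x ↦ ?_⟩
  · rw [dist_comm, dist_zero_right] at hcη
    exact (norm_le_pi_norm c i).trans_lt hcη
  · by_contra! h
    refine (mem_iInter.1 hc ⟨j, hj⟩) ⟨x, ?_⟩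
    ext k
    exact h k

open Set in
/-- A compact space has covering dimension less than `d` if it carries a point-separating algebra
of continuous functions all `d`-tuples of which have a nowhere dense range. -/
theorem coveringDimLE_of_separatesPoints {X : Type*} [TopologicalSpace X] [CompactSpace X]
    (A : Subalgebra ℝ C(X, ℝ)) (hA : A.SeparatesPoints) (d : ℕ)
    (hd : ∀ F : Fin d → C(X, ℝ), (∀ k, F k ∈ A) → Dense (range fun x k ↦ F k x)ᶜ) :
    CoveringDimLE X ((d : ℤ) - 1) := by
  classical
  -- Separation by continuous functions gives the Hausdorff property that Urysohn's lemma needs.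
  have : T2Space X := ⟨fun x y hxy ↦ by
    obtain ⟨-, ⟨f, -, rfl⟩, hf⟩ := hA hxy
    exact separated_by_continuous f.continuous hf⟩
  intro 𝒰 h𝒰 hcov
  have hloc : ∀ x, ∃ φ ∈ A, 0 < φ x ∧ ∃ U ∈ 𝒰, ∀ y, 0 < φ y → y ∈ U := fun x ↦ by
    obtain ⟨U, hU, hxU⟩ := mem_sUnion.1 (hcov ▸ mem_univ x)
    obtain ⟨φ, hφ, hx, h⟩ := exists_mem_subalgebra_pos_subset hA (h𝒰 U hU) hxU
    exact ⟨φ, hφ, hx, U, hU, h⟩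
  choose Φ hΦA hΦ hΦU using hloc
  obtain ⟨t, ht⟩ := CompactSpace.elim_nhds_subcover (fun x ↦ {y | 0 < Φ x y})
    fun x ↦ (isOpen_lt continuous_const (Φ x).continuous).mem_nhds (hΦ x)
  rcases isEmpty_or_nonempty X with hX | hX
  · exact ⟨∅, by simp, Subsingleton.elim _ _, by simp, fun x ↦ isEmptyElim x⟩
  have htpos : ∀ y, ∃ i : t, 0 < Φ i y := fun y ↦ by
    obtain ⟨i, hi, h⟩ := mem_iUnion₂.1 (ht.symm ▸ mem_univ y : y ∈ ⋃ x ∈ t, {y | 0 < Φ x y})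
    exact ⟨⟨i, hi⟩, h⟩
  have : Nonempty t := (htpos hX.some).nonempty
  have hmax : ∀ ψ : t → C(X, ℝ), ∃ m : C(X, ℝ), (∀ i x, ψ i x ≤ m x) ∧
      ∀ x, ∃ i, m x = ψ i x := fun ψ ↦ by
    refine ⟨⟨fun x ↦ Finset.univ.sup' Finset.univ_nonempty fun i ↦ ψ i x,
      Continuous.finset_sup'_apply _ fun i _ ↦ (ψ i).continuous⟩, fun i x ↦ ?_, fun x ↦ ?_⟩
    · exact Finset.le_sup' (fun i ↦ ψ i x) (Finset.mem_univ i)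
    · obtain ⟨i, -, hi⟩ := Finset.exists_mem_eq_sup' Finset.univ_nonempty fun i ↦ ψ i x
      exact ⟨i, hi⟩
  have hbelow : ∀ g : C(X, ℝ), (∀ x, 0 < g x) → ∃ ε > 0, ∀ x, ε ≤ g x := fun g hg ↦ by
    obtain ⟨x, -, hx⟩ := isCompact_univ.exists_isMinOn univ_nonempty g.continuous.continuousOn
    exact ⟨g x, hg x, fun y ↦ hx (mem_univ y)⟩
  obtain ⟨m₀, hm₀, hm₀'⟩ := hmax fun i ↦ Φ i
  obtain ⟨η, hη, hηm⟩ := hbelow m₀ fun x ↦ by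
    obtain ⟨i, hi⟩ := htpos x
    exact hi.trans_le (hm₀ i x)
  obtain ⟨c, hcη, hc⟩ := exists_generic_shift A hd (fun i : t ↦ Φ i) (fun i ↦ hΦA i)
    (show 0 < η / 4 by positivity)
  obtain ⟨m, hm, hm'⟩ := hmax fun i ↦ Φ i - algebraMap ℝ _ (c i)
  simp only [ContinuousMap.sub_apply, algebraMap_apply, smul_eq_mul, mul_one]
    at hm hm'
  -- The total gap to the maximum. It vanishes only where all `d + 1` shifted functions agree, which
  -- the choice of `c` excludes, so compactness bounds it below.
  let S : (Fin (d + 1) → t) → C(X, ℝ) := fun j ↦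
    ∑ k, (m - (Φ (j k) - algebraMap ℝ _ (c (j k))))
  have hS : ∀ j x, S j x = ∑ k, (m x - (Φ (j k) x - c (j k))) := fun j x ↦ by
    simp [S, ContinuousMap.sum_apply]
  have hSpos : ∀ j : {j : Fin (d + 1) → t // Function.Injective j},
      ∃ ε > 0, ∀ x, ε ≤ S j.1 x := fun ⟨j, hj⟩ ↦ by
    refine hbelow _ fun x ↦ ?_
    rw [hS]
    have hnn : ∀ k ∈ Finset.univ, 0 ≤ m x - (Φ (j k) x - c (j k)) := fun k _ ↦
      sub_nonneg.2 (hm (j k) x)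
    refine (Finset.sum_nonneg hnn).lt_of_ne' fun h0 ↦ ?_
    rw [Finset.sum_eq_zero_iff_of_nonneg hnn] at h0
    obtain ⟨k, hk⟩ := hc j hj x
    have h1 := h0 k.succ (Finset.mem_univ _)
    have h2 := h0 0 (Finset.mem_univ _)
    exact hk (by linarith)
  choose e he heS using hSpos
  obtain ⟨ε, hε, hεη, hεe⟩ : ∃ ε > 0, ε ≤ η / 4 ∧ ∀ j, ε * (d + 1) ≤ e j := by
    have : Finite {j : Fin (d + 1) → t // Function.Injective j} := inferInstance
    obtain ⟨δ, hδ, hδe⟩ : ∃ δ > 0, ∀ j, δ ≤ e j := by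
      rcases isEmpty_or_nonempty {j : Fin (d + 1) → t // Function.Injective j} with h | h
      · exact ⟨1, one_pos, fun j ↦ isEmptyElim j⟩
      · obtain ⟨j, hj⟩ := Finite.exists_min e
        exact ⟨e j, he j, hj⟩
    refine ⟨min (η / 4) (δ / (d + 1)), by positivity, min_le_left _ _, fun j ↦ ?_⟩
    calc min (η / 4) (δ / (d + 1)) * (d + 1) ≤ δ / (d + 1) * (d + 1) := by
          gcongr; exact min_le_right _ _
      _ = δ := by field_simp
      _ ≤ e j := hδe j
  -- On `V i`, `Φ i > η - η/4 - η/4 - η/4 > 0`, which gives the refinement. A point in `d + 1` of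
  -- these sets would have total gap below `(d + 1) * ε`.
  let V : t → Set X := fun i ↦ {x | m x - ε < Φ i x - c i}
  refine ⟨range V, ?_, ?_, ?_, fun x ↦ ?_⟩
  · rintro _ ⟨i, rfl⟩
    exact isOpen_lt (by fun_prop) (by fun_prop)
  · refine eq_univ_of_forall fun x ↦ ?_
    obtain ⟨i, hi⟩ := hm' x
    exact mem_sUnion.2 ⟨V i, ⟨i, rfl⟩, show m x - ε < _ by rw [hi]; linarith⟩
  · rintro _ ⟨i, rfl⟩
    obtain ⟨U, hU, hiU⟩ := hΦU i
    refine ⟨U, hU, fun x (hx : m x - ε < _) ↦ hiU x ?_⟩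
    obtain ⟨k, hk⟩ := hm₀' x
    have h1 := hm k x
    have h2 := hηm x
    have h3 := abs_lt.1 (hcη k)
    have h4 := abs_lt.1 (hcη i)
    linarith
  · have hsub : {W ∈ range V | x ∈ W} ⊆ V '' {i | x ∈ V i} := by
      rintro _ ⟨⟨i, rfl⟩, hi⟩
      exact ⟨i, hi, rfl⟩
    have hfin : (V '' {i | x ∈ V i}).Finite := (toFinite _).image V
    refine ⟨hfin.subset hsub, ?_⟩
    have hcard : {i | x ∈ V i}.ncard ≤ d := by
      by_contra! h
      rw [← Nat.card_coe_set_eq] at h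
      obtain ⟨j⟩ : Nonempty (Fin (d + 1) ↪ {i | x ∈ V i}) :=
        Function.Embedding.nonempty_of_card_le (by
          rw [Fintype.card_fin, ← Nat.card_eq_fintype_card]; exact h)
      have h1 := heS ⟨fun k ↦ (j k).1, fun a b hab ↦ j.injective (Subtype.ext hab)⟩ x
      have h2 := hεe ⟨fun k ↦ (j k).1, fun a b hab ↦ j.injective (Subtype.ext hab)⟩
      rw [hS] at h1
      have h3 : ∑ k, (m x - (Φ (j k).1 x - c (j k).1)) < ∑ _k : Fin (d + 1), ε :=
        Finset.sum_lt_sum_of_nonempty Finset.univ_nonempty fun k _ ↦ by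
          have : m x - ε < Φ (j k).1 x - c (j k).1 := (j k).2
          linarith
      simp only [Finset.sum_const, Finset.card_univ, Fintype.card_fin, nsmul_eq_mul,
        Nat.cast_add, Nat.cast_one] at h3
      linarith
    have := (ncard_le_ncard hsub hfin).trans ((ncard_image_le (toFinite _)).trans hcard)
    omega

/-! ### Wasserstein distance: integrals and transport plans -/

open MeasureTheory in
instance AntiVRThickening.instIsProbabilityMeasure {X : Type*} [MetricSpace X] [MeasurableSpace X]
    {r : ℝ} (μ : AntiVRThickening X r) : IsProbabilityMeasure μ.1 := by
  obtain ⟨μ, s, w, -, hw, -, rfl⟩ := μ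
  refine ⟨?_⟩
  simp only [Measure.coe_finsetSum, Finset.sum_apply, Measure.smul_apply, measure_univ,
    smul_eq_mul, mul_one]
  exact_mod_cast hw

open MeasureTheory in
/-- Integration of a continuous function on a compact space is continuous for the Wasserstein
distance. -/
theorem exists_forall_wasserstein_lt_abs_integral_sub_lt {X : Type*} [MetricSpace X]
    [CompactSpace X] [MeasurableSpace X] [BorelSpace X] (g : C(X, ℝ)) {ε : ℝ} (hε : 0 < ε) :
    ∃ δ : ℝ≥0∞, 0 < δ ∧ ∀ (μ ν : Measure X) [IsProbabilityMeasure μ], wasserstein μ ν < δ →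
      |∫ x, g x ∂ν - ∫ x, g x ∂μ| < ε := by
  obtain ⟨ρ, hρ, hg⟩ := Metric.uniformContinuous_iff.1
    (CompactSpace.uniformContinuous_of_continuous g.continuous) (ε / 2) (half_pos hε)
  -- A continuous function is Lipschitz up to an additive error: uniform continuity handles near
  -- points, boundedness far ones.
  have hlip : ∀ x y, |g y - g x| ≤ ε / 2 + 2 * ‖g‖ / ρ * dist x y := fun x y ↦ by
    rcases lt_or_ge (dist y x) ρ with h | h
    · have h1 : |g y - g x| < ε / 2 := hg h
      have h2 : 0 ≤ 2 * ‖g‖ / ρ * dist x y := by positivity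
      linarith
    · have h1 : |g y - g x| ≤ |g y| + |g x| := abs_sub _ _
      have h2 : |g y| ≤ ‖g‖ := g.norm_coe_le_norm y
      have h3 : |g x| ≤ ‖g‖ := g.norm_coe_le_norm x
      have h4 : 2 * ‖g‖ ≤ 2 * ‖g‖ / ρ * dist x y := by
        rw [div_mul_eq_mul_div, le_div_iff₀ hρ, dist_comm]
        gcongr
      linarith
  set K := 2 * ‖g‖ / ρ with hK
  have hK0 : 0 ≤ K := by positivity
  -- `K + 1` instead of `K`, as `K = 0` for `g = 0`.
  refine ⟨ENNReal.ofReal (ε / 2 / (K + 1)), by simp; positivity, fun μ ν _ hμν ↦ ?_⟩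
  simp only [wasserstein, iInf_lt_iff] at hμν
  obtain ⟨γ, rfl, rfl, hγ⟩ := hμν
  have : IsProbabilityMeasure γ := Measure.isProbabilityMeasure_of_map Prod.fst
  rw [integral_map (by fun_prop) (by fun_prop), integral_map (by fun_prop) (by fun_prop),
    ← integral_sub]
  rotate_left
  · exact (g.continuous.comp continuous_snd).integrable_of_hasCompactSupport
      (HasCompactSupport.of_compactSpace _)
  · exact (g.continuous.comp continuous_fst).integrable_of_hasCompactSupport
      (HasCompactSupport.of_compactSpace _)
  have hdist : Integrable (fun z : X × X ↦ dist z.1 z.2) γ :=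
    (continuous_fst.dist continuous_snd).integrable_of_hasCompactSupport
      (HasCompactSupport.of_compactSpace _)
  have hcost : ∫ z, dist z.1 z.2 ∂γ < ε / 2 / (K + 1) := by
    rw [integral_eq_lintegral_of_nonneg_ae (.of_forall fun _ ↦ dist_nonneg)
      hdist.aestronglyMeasurable]
    simp_rw [← edist_dist]
    exact (ENNReal.lt_ofReal_iff_toReal_lt hγ.ne_top).1 hγ
  calc |∫ z, (g z.2 - g z.1) ∂γ| ≤ ∫ z, |g z.2 - g z.1| ∂γ := abs_integral_le_integral_abs
    _ ≤ ∫ z, (ε / 2 + K * dist z.1 z.2) ∂γ := by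
        refine integral_mono_of_nonneg (.of_forall fun _ ↦ abs_nonneg _)
          ((integrable_const _).add (hdist.const_mul K)) (.of_forall fun z ↦ hlip z.1 z.2)
    _ = ε / 2 + K * ∫ z, dist z.1 z.2 ∂γ := by
        rw [integral_add (integrable_const _) (hdist.const_mul K), integral_const_mul]
        simp
    _ < ε := by
        have h0 : 0 ≤ ∫ z, dist z.1 z.2 ∂γ := integral_nonneg fun _ ↦ dist_nonneg
        have h1 := (lt_div_iff₀ (by positivity)).1 hcost
        have h2 : K * ∫ z, dist z.1 z.2 ∂γ ≤ (∫ z, dist z.1 z.2 ∂γ) * (K + 1) := by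
          nlinarith
        linarith

theorem AntiVRThickening.continuous_integral {X : Type*} [MetricSpace X] [CompactSpace X]
    [MeasurableSpace X] [BorelSpace X] (r : ℝ) (g : C(X, ℝ)) :
    Continuous fun μ : AntiVRThickening X r ↦ ∫ x, g x ∂μ.1 := by
  refine continuous_def.2 fun U hU μ hμ ↦ ?_
  obtain ⟨ε, hε, hεU⟩ := Metric.isOpen_iff.1 hU _ hμ
  obtain ⟨δ, hδ, h⟩ := exists_forall_wasserstein_lt_abs_integral_sub_lt g hε
  exact ⟨δ, hδ, fun ν hν ↦ hεU (h μ.1 ν.1 hν)⟩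

open MeasureTheory in
/-- A matrix with prescribed row and column sums is a transport plan of discrete measures. -/
theorem wasserstein_sum_dirac_le {X : Type*} [MetricSpace X] [SecondCountableTopology X]
    [MeasurableSpace X] [BorelSpace X] {ι : Type*} [Fintype ι] (x y : ι → X) (w v : ι → ℝ≥0∞)
    (q : ι → ι → ℝ≥0∞) (hw : ∀ i, ∑ j, q i j = w i) (hv : ∀ j, ∑ i, q i j = v j) :
    wasserstein (∑ i, w i • Measure.dirac (x i)) (∑ j, v j • Measure.dirac (y j)) ≤
      ∑ i, ∑ j, q i j * edist (x i) (y j) := by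
  let γ : Measure (X × X) := ∑ i, ∑ j, q i j • Measure.dirac (x i, y j)
  have hmap : ∀ f : X × X → X, Measurable f →
      γ.map f = ∑ i, ∑ j, q i j • Measure.dirac (f (x i, y j)) := fun f hf ↦ by
    simp only [γ, ← Measure.mapₗ_apply_of_measurable hf, map_sum, map_smul]
    simp only [Measure.mapₗ_apply_of_measurable hf, Measure.map_dirac' hf]
  refine iInf_le_of_le γ (iInf_le_of_le ?_ (iInf_le_of_le ?_ ?_))
  · rw [hmap _ measurable_fst]
    exact Finset.sum_congr rfl fun i _ ↦ by rw [← hw i, Finset.sum_smul]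
  · rw [hmap _ measurable_snd, Finset.sum_comm]
    exact Finset.sum_congr rfl fun i _ ↦ by rw [← hv i, Finset.sum_smul]
  · have hm : Measurable fun z : X × X ↦ edist z.1 z.2 := by fun_prop
    simp only [γ, lintegral_finsetSum_measure, lintegral_smul_measure, lintegral_dirac' _ hm,
      smul_eq_mul, le_refl]

/-- Two weight vectors are the row and column sums of a matrix that is almost diagonal if they are
close to each other. -/
theorem exists_coupling_sum_mul_le {ι : Type*} [Fintype ι] {w v : ι → ℝ}
    (hw : w ∈ stdSimplex ℝ ι) (hv : v ∈ stdSimplex ℝ ι) :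
    ∃ q : ι → ι → ℝ, (∀ i j, 0 ≤ q i j) ∧ (∀ i, ∑ j, q i j = w i) ∧ (∀ j, ∑ i, q i j = v j) ∧
      ∀ (c : ι → ι → ℝ) (D : ℝ), (∀ i j, 0 ≤ c i j) → (∀ i j, c i j ≤ D) →
        ∑ i, ∑ j, q i j * c i j ≤ ∑ i, c i i + D * ∑ i, |w i - v i| := by
  classical
  -- The common mass `m` stays on the diagonal; the surpluses of `w` and `v` have equal total `t`
  -- and are coupled by their product divided by `t`.
  let m : ι → ℝ := fun i ↦ min (w i) (v i)
  let t := ∑ i, (w i - m i)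
  have ht' : t = ∑ i, (v i - m i) := by
    simp only [t, Finset.sum_sub_distrib, hw.2, hv.2]
  have ha : ∀ i, 0 ≤ w i - m i := fun i ↦ sub_nonneg.2 (min_le_left _ _)
  have hb : ∀ i, 0 ≤ v i - m i := fun i ↦ sub_nonneg.2 (min_le_right _ _)
  have ht : 0 ≤ t := Finset.sum_nonneg fun i _ ↦ ha i
  have hm0 : ∀ i, 0 ≤ m i := fun i ↦ le_min (hw.1 i) (hv.1 i)
  have hm1 : ∀ i, m i ≤ 1 := fun i ↦ (min_le_left _ _).trans (by
    rw [← hw.2]; exact Finset.single_le_sum (fun j _ ↦ hw.1 j) (Finset.mem_univ i))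
  -- For `t = 0` there is no surplus, and `t⁻¹ = 0` does no harm.
  have hcancel : ∀ a, 0 ≤ a → a ≤ t → a * t⁻¹ * t = a := fun a h0 h1 ↦ by
    rcases eq_or_ne t 0 with h | h
    · rw [le_antisymm (h ▸ h1) h0]; simp
    · field_simp
  have hat : ∀ i, w i - m i ≤ t := fun i ↦
    Finset.single_le_sum (fun j _ ↦ ha j) (Finset.mem_univ i)
  have hbt : ∀ i, v i - m i ≤ t := fun i ↦ ht' ▸
    Finset.single_le_sum (fun j _ ↦ hb j) (Finset.mem_univ i)
  let ρ : ι → ι → ℝ := fun i j ↦ (w i - m i) * t⁻¹ * (v j - m j)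
  have hρ : ∀ i j, 0 ≤ ρ i j := fun i j ↦
    mul_nonneg (mul_nonneg (ha i) (inv_nonneg.2 ht)) (hb j)
  have hρrow : ∀ i, ∑ j, ρ i j = w i - m i := fun i ↦ by
    rw [← Finset.mul_sum, ← ht', hcancel _ (ha i) (hat i)]
  have hρcol : ∀ j, ∑ i, ρ i j = v j - m j := fun j ↦ by
    rw [← Finset.sum_mul, ← Finset.sum_mul, mul_assoc, mul_comm, mul_comm t⁻¹,
      hcancel _ (hb j) (hbt j)]
  refine ⟨fun i j ↦ (if i = j then m i else 0) + ρ i j, fun i j ↦ ?_, fun i ↦ ?_, fun j ↦ ?_,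
    fun c D hc hcD ↦ ?_⟩
  · exact add_nonneg (by split_ifs <;> simp [hm0]) (hρ i j)
  · rw [Finset.sum_add_distrib, hρrow]; simp
  · rw [Finset.sum_add_distrib, hρcol]; simp
  · have h1 : ∑ i, ∑ j, ((if i = j then m i else 0) + ρ i j) * c i j =
        ∑ i, m i * c i i + ∑ i, ∑ j, ρ i j * c i j := by
      simp [add_mul, Finset.sum_add_distrib, ite_mul]
    have h2 : ∑ i, ∑ j, ρ i j * c i j ≤ ∑ i, (w i - m i) * D := by
      refine Finset.sum_le_sum fun i _ ↦ ?_
      rw [← hρrow i, Finset.sum_mul]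
      exact Finset.sum_le_sum fun j _ ↦ mul_le_mul_of_nonneg_left (hcD i j) (hρ i j)
    have h3 : ∑ i, (w i - m i) * D ≤ D * ∑ i, |w i - v i| := by
      rw [Finset.mul_sum]
      refine Finset.sum_le_sum fun i _ ↦ ?_
      rw [mul_comm]
      refine mul_le_mul_of_nonneg_left ?_ ((hc i i).trans (hcD i i))
      rcases le_total (w i) (v i) with h | h
      · simp [m, h]
      · simp only [m, min_eq_right h]; exact le_abs_self _
    have h4 : ∑ i, m i * c i i ≤ ∑ i, c i i :=
      Finset.sum_le_sum fun i _ ↦ mul_le_of_le_one_left (hc i i) (hm1 i)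
    linarith

open MeasureTheory in
theorem wasserstein_sum_ofReal_dirac_le {X : Type*} [MetricSpace X] [SecondCountableTopology X]
    [MeasurableSpace X] [BorelSpace X] {ι : Type*} [Fintype ι] (x y : ι → X) {w v : ι → ℝ}
    (hw : w ∈ stdSimplex ℝ ι) (hv : v ∈ stdSimplex ℝ ι) {D : ℝ} (hD : ∀ x y : X, dist x y ≤ D) :
    wasserstein (∑ i, ENNReal.ofReal (w i) • Measure.dirac (x i))
      (∑ i, ENNReal.ofReal (v i) • Measure.dirac (y i)) ≤
      ENNReal.ofReal (∑ i, dist (x i) (y i) + D * ∑ i, |w i - v i|) := by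
  obtain ⟨q, hq, hqw, hqv, hcost⟩ := exists_coupling_sum_mul_le hw hv
  refine (wasserstein_sum_dirac_le x y _ _ (fun i j ↦ ENNReal.ofReal (q i j)) (fun i ↦ ?_)
    fun j ↦ ?_).trans ?_
  · rw [← hqw i, ENNReal.ofReal_sum_of_nonneg fun j _ ↦ hq i j]
  · rw [← hqv j, ENNReal.ofReal_sum_of_nonneg fun i _ ↦ hq i j]
  · refine le_trans (le_of_eq ?_) (ENNReal.ofReal_le_ofReal
      (hcost (fun i j ↦ dist (x i) (y j)) D (fun _ _ ↦ dist_nonneg) fun _ _ ↦ hD _ _))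
    rw [ENNReal.ofReal_sum_of_nonneg fun i _ ↦
      Finset.sum_nonneg fun j _ ↦ mul_nonneg (hq i j) dist_nonneg]
    refine Finset.sum_congr rfl fun i _ ↦ ?_
    rw [ENNReal.ofReal_sum_of_nonneg fun j _ ↦ mul_nonneg (hq i j) dist_nonneg]
    exact Finset.sum_congr rfl fun j _ ↦ by rw [ENNReal.ofReal_mul (hq i j), edist_dist]

/-! ### Parametrization by weighted configurations -/

/-- The pairs of a `p`-tuple of points and a `p`-tuple of weights, which is a probability vector,
such that any two distinct points of positive weight are at distance at least `r`. -/
def weightedConfigurations (X : Type*) [MetricSpace X] (r : ℝ) (p : ℕ) :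
    Set ((Fin p → X) × (Fin p → ℝ)) :=
  {z | z.2 ∈ stdSimplex ℝ (Fin p) ∧
    ∀ i j, z.2 i = 0 ∨ z.2 j = 0 ∨ z.1 i = z.1 j ∨ r ≤ dist (z.1 i) (z.1 j)}

/-- Allowing zero weights and coinciding points makes the separation condition closed. -/
theorem isCompact_weightedConfigurations (X : Type*) [MetricSpace X] [CompactSpace X] (r : ℝ)
    (p : ℕ) : IsCompact (weightedConfigurations X r p) := by
  refine (isCompact_univ.prod (isCompact_stdSimplex ℝ (Fin p))).of_isClosed_subset ?_
    fun z hz ↦ ⟨Set.mem_univ _, hz.1⟩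
  have h : weightedConfigurations X r p = Prod.snd ⁻¹' stdSimplex ℝ (Fin p) ∩ ⋂ i, ⋂ j,
      ({z : (Fin p → X) × (Fin p → ℝ) | z.2 i = 0} ∪ ({z | z.2 j = 0} ∪
        ({z | z.1 i = z.1 j} ∪ {z | r ≤ dist (z.1 i) (z.1 j)}))) := by
    ext z
    simp [weightedConfigurations]
  rw [h]
  refine ((isClosed_stdSimplex ℝ (Fin p)).preimage continuous_snd).inter
    (isClosed_iInter fun i ↦ isClosed_iInter fun j ↦ ?_)
  exact (isClosed_eq (by fun_prop) (by fun_prop)).union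
    ((isClosed_eq (by fun_prop) (by fun_prop)).union
      ((isClosed_eq (by fun_prop) (by fun_prop)).union
        (isClosed_le (by fun_prop) (by fun_prop))))

open MeasureTheory in
/-- The discrete measure of a weighted configuration. -/
noncomputable def weightedConfigurations.toThickening {X : Type*} [MetricSpace X]
    [MeasurableSpace X] {r : ℝ} {p : ℕ} (z : weightedConfigurations X r p) :
    AntiVRThickening X r :=
  ⟨∑ i, ENNReal.ofReal (z.1.2 i) • Measure.dirac (z.1.1 i), by
    classical
    obtain ⟨⟨x, w⟩, ⟨hw0, hw1⟩, hr⟩ := z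
    simp only at hw0 hw1 hr ⊢
    -- Indices of weight zero are dropped, and the weights of coinciding points are added.
    let I : Finset (Fin p) := {i | w i ≠ 0}
    have hI : ∀ i ∈ I, x i ∈ I.image x := fun i hi ↦ Finset.mem_image_of_mem x hi
    refine ⟨I.image x, fun y ↦ ∑ i ∈ I with x i = y, (w i).toNNReal, fun y hy ↦ ?_, ?_,
      fun y hy y' hy' hne ↦ ?_, ?_⟩
    · obtain ⟨i, hi, rfl⟩ := Finset.mem_image.1 hy
      refine Finset.sum_pos (fun j hj ↦ ?_) ⟨i, by simp [hi]⟩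
      have hj : w j ≠ 0 := (Finset.mem_filter.1 (Finset.mem_filter.1 hj).1).2
      exact Real.toNNReal_pos.2 ((hw0 j).lt_of_ne' hj)
    · rw [Finset.sum_fiberwise_of_maps_to hI, Finset.sum_filter_of_ne (by
        intro i _ h h0
        simp [h0] at h), ← Real.toNNReal_sum_of_nonneg fun i _ ↦ hw0 i, hw1, Real.toNNReal_one]
    · obtain ⟨i, hi, rfl⟩ := Finset.mem_image.1 hy
      obtain ⟨j, hj, rfl⟩ := Finset.mem_image.1 hy'
      rcases hr i j with h | h | h | h
      · exact absurd h (Finset.mem_filter.1 hi).2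
      · exact absurd h (Finset.mem_filter.1 hj).2
      · exact absurd h hne
      · exact h
    · have h1 : ∀ y ∈ I.image x, ((∑ i ∈ I with x i = y, (w i).toNNReal : ℝ≥0) : ℝ≥0∞) •
          Measure.dirac y = ∑ i ∈ I with x i = y, ENNReal.ofReal (w i) • Measure.dirac (x i) :=
        fun y _ ↦ by
          rw [ENNReal.ofNNReal_finsetSum, Finset.sum_smul]
          refine Finset.sum_congr rfl fun i hi ↦ ?_
          rw [(Finset.mem_filter.1 hi).2]
          rfl
      rw [Finset.sum_congr rfl h1, Finset.sum_fiberwise_of_maps_to hI, Finset.sum_filter_of_ne]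
      intro i _ h h0
      simp [h0] at h⟩

open MeasureTheory in
theorem weightedConfigurations.integral_toThickening {X : Type*} [MetricSpace X] [CompactSpace X]
    [MeasurableSpace X] [BorelSpace X] {r : ℝ} {p : ℕ} (z : weightedConfigurations X r p)
    (g : C(X, ℝ)) : ∫ x, g x ∂(toThickening z).1 = ∑ i, z.1.2 i * g (z.1.1 i) := by
  rw [toThickening, integral_finsetSum_measure]
  · refine Finset.sum_congr rfl fun i _ ↦ ?_
    rw [integral_smul_measure, integral_dirac, ENNReal.toReal_ofReal (z.2.1.1 i), smul_eq_mul]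
  · exact fun i _ ↦ (g.continuous.integrable_of_hasCompactSupport
      (HasCompactSupport.of_compactSpace _)).smul_measure ENNReal.ofReal_ne_top

theorem weightedConfigurations.continuous_toThickening {X : Type*} [MetricSpace X]
    [CompactSpace X] [MeasurableSpace X] [BorelSpace X] (r : ℝ) (p : ℕ) :
    Continuous (toThickening : weightedConfigurations X r p → AntiVRThickening X r) := by
  refine continuous_def.2 fun U hU ↦ isOpen_iff_mem_nhds.2 fun z hz ↦ ?_
  obtain ⟨ε, hε, hεU⟩ := hU _ hz
  let b : weightedConfigurations X r p → ℝ := fun y ↦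
    ∑ i, dist (z.1.1 i) (y.1.1 i) + Metric.diam (Set.univ : Set X) * ∑ i, |z.1.2 i - y.1.2 i|
  have hb : Continuous fun y ↦ ENNReal.ofReal (b y) :=
    ENNReal.continuous_ofReal.comp (by fun_prop)
  have hbz : ENNReal.ofReal (b z) < ε := by simpa [b] using hε
  filter_upwards [hb.continuousAt.eventually_lt_const hbz] with y hy
  refine hεU _ ((wasserstein_sum_ofReal_dirac_le _ _ z.2.1 y.2.1 fun x x' ↦ ?_).trans_lt hy)
  exact Metric.dist_le_diam_of_mem isCompact_univ.isBounded (Set.mem_univ x) (Set.mem_univ x')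

open MeasureTheory in
theorem weightedConfigurations.surjective_toThickening {X : Type*} [MetricSpace X]
    [MeasurableSpace X] {r : ℝ} {p : ℕ} (hp : packNumber X r ≤ p) :
    Function.Surjective
      (toThickening : weightedConfigurations X r p → AntiVRThickening X r) := by
  classical
  rintro ⟨μ, s, w, hw0, hw1, hs, rfl⟩
  have hcard : s.card ≤ p := by
    have h : (s : Set X).encard ≤ p :=
      (le_iSup₂ (f := fun (S : Set X) (_ : S.Pairwise fun x y ↦ r ≤ dist x y) ↦ S.encard)
        (s : Set X) fun x hx y hy hxy ↦ hs x hx y hy hxy).trans hp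
    rw [Set.encard_coe_eq_coe_finsetCard] at h
    exact_mod_cast h
  obtain ⟨e⟩ : Nonempty (s ↪ Fin p) := Function.Embedding.nonempty_of_card_le (by simpa)
  obtain ⟨x₀, hx₀⟩ : s.Nonempty := Finset.nonempty_of_sum_ne_zero (hw1 ▸ one_ne_zero)
  -- Unused slots are filled with an arbitrary atom of weight `0`.
  let x : Fin p → X := Function.extend e Subtype.val fun _ ↦ x₀
  let v : Fin p → ℝ := Function.extend e (fun y ↦ (w y : ℝ)) 0
  have hx : ∀ y, x (e y) = y := e.injective.extend_apply _ _
  have hv : ∀ y, v (e y) = w y := e.injective.extend_apply _ _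
  have hv0 : ∀ i, i ∉ Set.range e → v i = 0 := fun i hi ↦
    Function.extend_apply' _ _ i hi
  have hmem : (x, v) ∈ weightedConfigurations X r p := by
    refine ⟨⟨fun i ↦ ?_, ?_⟩, fun i j ↦ ?_⟩
    · by_cases hi : i ∈ Set.range e
      · obtain ⟨y, rfl⟩ := hi
        simp only [hv]; exact (w y).2
      · exact (hv0 i hi).ge
    · simp only
      rw [← Fintype.sum_of_injective e e.injective (fun y ↦ (w y : ℝ)) v hv0 fun y ↦ (hv y).symm,
        Finset.sum_coe_sort s fun y ↦ (w y : ℝ)]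
      exact_mod_cast hw1
    · by_cases hi : i ∈ Set.range e
      · by_cases hj : j ∈ Set.range e
        · obtain ⟨y, rfl⟩ := hi
          obtain ⟨y', rfl⟩ := hj
          simp only [hx]
          by_cases hyy : (y : X) = y'
          · exact .inr (.inr (.inl hyy))
          · exact .inr (.inr (.inr (hs _ y.2 _ y'.2 hyy)))
        · exact .inr (.inl (hv0 j hj))
      · exact .inl (hv0 i hi)
  refine ⟨⟨(x, v), hmem⟩, Subtype.ext ?_⟩
  change ∑ i, ENNReal.ofReal (v i) • Measure.dirac (x i) =
    ∑ y ∈ s, (w y : ℝ≥0∞) • Measure.dirac y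
  rw [← Finset.sum_coe_sort s fun y ↦ (w y : ℝ≥0∞) • Measure.dirac y]
  refine (Fintype.sum_of_injective e e.injective _ _ (fun i hi ↦ ?_) fun y ↦ ?_).symm
  · simp [hv0 i hi]
  · rw [hv, hx, ENNReal.ofReal_coe_nnreal]

/-- A ball of radius `r / 2` holds at most one point of an `r`-separated set, and finitely many such
balls cover. -/
theorem packNumber_ne_top {X : Type*} [MetricSpace X] [CompactSpace X] {r : ℝ} (hr : 0 < r) :
    packNumber X r ≠ ⊤ := by
  obtain ⟨t, ht, hcov⟩ := Metric.totallyBounded_iff.1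
    (isCompact_univ (X := X)).totallyBounded (r / 2) (half_pos hr)
  have hnear : ∀ x, ∃ y ∈ t, dist x y < r / 2 := fun x ↦ by
    simpa using hcov (Set.mem_univ x)
  choose f hft hf using hnear
  refine ne_top_of_le_ne_top ht.encard_lt_top.ne (iSup₂_le fun S hS ↦ ?_)
  refine Set.encard_le_encard_of_injOn (f := f) (fun x _ ↦ hft x) fun x hx y hy hxy ↦ ?_
  by_contra hne
  have h1 := hS hx hy hne
  have h2 := dist_triangle_right x y (f x)
  have h3 := hf x
  have h4 := hf y
  rw [← hxy] at h4
  linarith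

/-! ### Smooth functions of measures and Hausdorff dimension -/

/-- The normalization determines the first weight. This lost dimension makes the count strictly less
than `(n + 1) * p`. -/
theorem dimH_setOf_sum_snd_eq_one_le (E : Type*) [NormedAddCommGroup E] [NormedSpace ℝ E]
    [FiniteDimensional ℝ E] (q : ℕ) :
    dimH {u : E × (Fin (q + 1) → ℝ) | ∑ i, u.2 i = 1} ≤ (Module.finrank ℝ E + q : ℕ) := by
  let f : E × (Fin q → ℝ) → E × (Fin (q + 1) → ℝ) := fun u ↦
    (u.1, fun i ↦ (Fin.cons (1 - ∑ j, u.2 j) u.2 : Fin (q + 1) → ℝ) i)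
  have hf : ContDiff ℝ 1 f := by
    refine contDiff_fst.prodMk (contDiff_pi.2 fun i ↦ ?_)
    refine Fin.cases ?_ (fun j ↦ ?_) i
    · simp only [Fin.cons_zero]; fun_prop
    · simp only [Fin.cons_succ]; fun_prop
  have hsub : {u : E × (Fin (q + 1) → ℝ) | ∑ i, u.2 i = 1} ⊆ Set.range f := by
    rintro ⟨x, w⟩ (hw : ∑ i, w i = 1)
    refine ⟨(x, fun j ↦ w j.succ), Prod.ext rfl (funext fun i ↦ ?_)⟩
    rw [Fin.sum_univ_succ] at hw
    refine Fin.cases ?_ (fun j ↦ ?_) i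
    · simp only [f, Fin.cons_zero]; linarith
    · simp only [f, Fin.cons_succ]
  refine (dimH_mono hsub).trans (hf.dimH_range_le.trans ?_)
  simp

theorem ContDiffOn.dimH_image_le_of_isOpen {E F : Type*} [NormedAddCommGroup E] [NormedSpace ℝ E]
    [FiniteDimensional ℝ E] [NormedAddCommGroup F] [NormedSpace ℝ F] {f : E → F} {s t : Set E}
    (hf : ContDiffOn ℝ 1 f t) (ht : IsOpen t) (hst : s ⊆ t) : dimH (f '' s) ≤ dimH s :=
  dimH_image_le_of_locally_lipschitzOn fun x hx ↦ by
    obtain ⟨K, v, hv, h⟩ := (hf.contDiffAt (ht.mem_nhds (hst hx))).exists_lipschitzOnWith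
    exact ⟨K, v, mem_nhdsWithin_of_mem_nhds hv, h⟩

/-- A function of discrete measures is smooth in charts if, in any charts of the points of a
weighted configuration, it is a continuously differentiable function of points and weights. -/
def IsSmoothInCharts {E M : Type*} [NormedAddCommGroup E] [NormedSpace ℝ E] [MetricSpace M]
    [ChartedSpace E M] [MeasurableSpace M] {r : ℝ} (p : ℕ) (φ : AntiVRThickening M r → ℝ) : Prop :=
  ∀ a : Fin p → M, ∃ ψ : (Fin p → E) × (Fin p → ℝ) → ℝ,
    ContDiffOn ℝ 1 ψ {u | ∀ i, u.1 i ∈ (chartAt E (a i)).target} ∧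
    ∀ z : weightedConfigurations M r p, (∀ i, z.1.1 i ∈ (chartAt E (a i)).source) →
      φ (weightedConfigurations.toThickening z) = ψ (fun i ↦ chartAt E (a i) (z.1.1 i), z.1.2)

namespace IsSmoothInCharts

variable {E M : Type*} [NormedAddCommGroup E] [NormedSpace ℝ E] [MetricSpace M]
  [ChartedSpace E M] [MeasurableSpace M] {r : ℝ} {p : ℕ} {φ φ' : AntiVRThickening M r → ℝ}

theorem const (c : ℝ) : IsSmoothInCharts (E := E) (M := M) (r := r) p fun _ ↦ c :=
  fun _ ↦ ⟨fun _ ↦ c, contDiffOn_const, fun _ _ ↦ rfl⟩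

theorem add (h : IsSmoothInCharts (E := E) p φ) (h' : IsSmoothInCharts (E := E) p φ') :
    IsSmoothInCharts (E := E) p fun μ ↦ φ μ + φ' μ := fun a ↦ by
  obtain ⟨ψ, hψ, h⟩ := h a
  obtain ⟨ψ', hψ', h'⟩ := h' a
  exact ⟨fun u ↦ ψ u + ψ' u, hψ.add hψ', fun z hz ↦ congrArg₂ (· + ·) (h z hz) (h' z hz)⟩

theorem mul (h : IsSmoothInCharts (E := E) p φ) (h' : IsSmoothInCharts (E := E) p φ') :
    IsSmoothInCharts (E := E) p fun μ ↦ φ μ * φ' μ := fun a ↦ by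
  obtain ⟨ψ, hψ, h⟩ := h a
  obtain ⟨ψ', hψ', h'⟩ := h' a
  exact ⟨fun u ↦ ψ u * ψ' u, hψ.mul hψ', fun z hz ↦ congrArg₂ (· * ·) (h z hz) (h' z hz)⟩

theorem integral [CompactSpace M] [BorelSpace M] [IsManifold 𝓘(ℝ, E) 1 M] {g : C(M, ℝ)}
    (hg : ContMDiff 𝓘(ℝ, E) 𝓘(ℝ, ℝ) 1 g) :
    IsSmoothInCharts (E := E) p fun μ : AntiVRThickening M r ↦ ∫ x, g x ∂μ.1 := fun a ↦ by
  refine ⟨fun u ↦ ∑ i, u.2 i * g ((chartAt E (a i)).symm (u.1 i)), ?_, fun z hz ↦ ?_⟩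
  · refine ContDiffOn.sum fun i _ ↦ ContDiffOn.mul (by fun_prop) ?_
    have h : ContDiffOn ℝ 1 (g ∘ (chartAt E (a i)).symm) (chartAt E (a i)).target :=
      contMDiffOn_iff_contDiffOn.1 (hg.comp_contMDiffOn contMDiffOn_chart_symm)
    exact h.comp (t := (chartAt E (a i)).target) 
      (f := fun u : (Fin p → E) × (Fin p → ℝ) ↦ u.1 i) (by fun_prop)
      fun u hu ↦ hu i
  · refine (weightedConfigurations.integral_toThickening z g).trans
      (Finset.sum_congr rfl fun i _ ↦ ?_)
    simp only [(chartAt E (a i)).left_inv (hz i)]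

-- Finitely many tuples of charts suffice, so the range lies in a finite union of `C^1` images of
-- pieces of the hyperplane of weight sum one.
open Set in
theorem dense_compl_range [CompactSpace M] [FiniteDimensional ℝ E]
    (hp : packNumber M r ≤ p) {d : ℕ} (hd : d = (Module.finrank ℝ E + 1) * p)
    (F : Fin d → AntiVRThickening M r → ℝ) (hF : ∀ k, IsSmoothInCharts (E := E) p (F k)) :
    Dense (range fun μ k ↦ F k μ)ᶜ := by
  have hsurj := weightedConfigurations.surjective_toThickening hp
  obtain _ | q := p
  -- For `p = 0` the empty sum of weights would have to be `1`.
  · have : IsEmpty (AntiVRThickening M r) := ⟨fun μ ↦ by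
      obtain ⟨z, -⟩ := hsurj μ
      simpa using z.2.1.2⟩
    simp [range_eq_empty]
  apply dense_compl_of_dimH_lt_finrank
  choose ψ hψ hFψ using hF
  obtain ⟨t, ht⟩ := CompactSpace.elim_nhds_subcover (fun x : M ↦ (chartAt E x).source)
    fun x ↦ chart_source_mem_nhds E x
  let T : (Fin (q + 1) → M) → Set ((Fin (q + 1) → E) × (Fin (q + 1) → ℝ)) := fun a ↦
    {u | ∀ i, u.1 i ∈ (chartAt E (a i)).target}
  have hT : ∀ a, IsOpen (T a) := fun a ↦ by
    simp only [T, ofPred_forall]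
    exact isOpen_iInter_of_finite fun i ↦
      (chartAt E (a i)).open_target.preimage (by fun_prop)
  let Ψ : (Fin (q + 1) → M) → (Fin (q + 1) → E) × (Fin (q + 1) → ℝ) → Fin d → ℝ :=
    fun a u k ↦ ψ k a u
  have hsub : (range fun μ k ↦ F k μ) ⊆ ⋃ a : Fin (q + 1) → t,
      Ψ (fun i ↦ a i) '' (T (fun i ↦ a i) ∩ {u | ∑ i, u.2 i = 1}) := by
    rintro _ ⟨μ, rfl⟩
    obtain ⟨z, rfl⟩ := hsurj μ
    have hz : ∀ i, ∃ y : t, z.1.1 i ∈ (chartAt E (y : M)).source := fun i ↦ by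
      have h : z.1.1 i ∈ ⋃ x ∈ t, (chartAt E x).source := ht.symm ▸ mem_univ _
      obtain ⟨y, hy, h⟩ := mem_iUnion₂.1 h
      exact ⟨⟨y, hy⟩, h⟩
    choose a ha using hz
    refine mem_iUnion.2 ⟨a, (fun i ↦ chartAt E (a i : M) (z.1.1 i), z.1.2),
      ⟨fun i ↦ (chartAt E (a i : M)).map_source (ha i), z.2.1.2⟩, funext fun k ↦ ?_⟩
    exact (hFψ k _ z ha).symm
  refine (dimH_mono hsub).trans_lt ?_
  rw [dimH_iUnion]
  refine lt_of_le_of_lt (iSup_le fun a ↦ ?_)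
    (?_ : ((Module.finrank ℝ (Fin (q + 1) → E) + q : ℕ) : ℝ≥0∞) < _)
  · exact (ContDiffOn.dimH_image_le_of_isOpen (contDiffOn_pi.2 fun k ↦ hψ k _) (hT _)
      inter_subset_left).trans
      ((dimH_mono inter_subset_right).trans (dimH_setOf_sum_snd_eq_one_le _ q))
  -- With `p = q + 1` and `n` the dimension of `E`: `(q + 1) * n + q < (n + 1) * (q + 1)`.
  · rw [Module.finrank_pi_fintype, Module.finrank_fin_fun, hd]
    simp only [Finset.sum_const, Finset.card_univ, Fintype.card_fin, smul_eq_mul]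
    norm_cast
    nlinarith

end IsSmoothInCharts

/-! ### Separation of measures and conclusion -/

open MeasureTheory in
/-- Finite measures on a compact manifold are determined by the integrals of smooth functions. -/
theorem MeasureTheory.Measure.ext_of_forall_contMDiff_integral_eq {E M : Type*}
    [NormedAddCommGroup E] [NormedSpace ℝ E] [FiniteDimensional ℝ E] [MetricSpace M]
    [CompactSpace M] [ChartedSpace E M] [IsManifold 𝓘(ℝ, E) ∞ M] [MeasurableSpace M]
    [BorelSpace M] {μ ν : Measure M} [IsProbabilityMeasure μ] [IsProbabilityMeasure ν]
    (h : ∀ g : C(M, ℝ), ContMDiff 𝓘(ℝ, E) 𝓘(ℝ, ℝ) 1 g → ∫ x, g x ∂μ = ∫ x, g x ∂ν) : μ = ν := by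
  refine ext_of_forall_integral_eq_of_IsFiniteMeasure fun f ↦ eq_of_forall_dist_le fun ε hε ↦ ?_
  obtain ⟨g, hg, -⟩ := f.continuous.exists_contMDiff_approx 𝓘(ℝ, E) 1
    (ε := fun _ ↦ ε / 2) continuous_const fun _ ↦ half_pos hε
  have hgc : Continuous g := g.contMDiff.continuous
  have hint : ∀ (κ : Measure M) [IsProbabilityMeasure κ],
      dist (∫ x, f x ∂κ) (∫ x, g x ∂κ) ≤ ε / 2 := fun κ _ ↦ by
    rw [dist_eq_norm, ← integral_sub (f.integrable κ)
      (hgc.integrable_of_hasCompactSupport (HasCompactSupport.of_compactSpace _))]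
    refine (norm_integral_le_of_norm_le_const (C := ε / 2) (.of_forall fun x ↦ ?_)).trans_eq
      (by simp)
    rw [← dist_eq_norm, dist_comm]
    exact (hg x).le
  have h1 := hint μ
  have h2 := hint ν
  have h3 : ∫ x, g x ∂μ = ∫ x, g x ∂ν := h ⟨g, hgc⟩ g.contMDiff
  rw [h3] at h1
  linarith [dist_triangle_right (∫ x, f x ∂μ) (∫ x, f x ∂ν) (∫ x, g x ∂ν)]

theorem coveringDimLE_antiVRThickening {E M : Type*} [NormedAddCommGroup E] [NormedSpace ℝ E]
    [FiniteDimensional ℝ E] [MetricSpace M] [CompactSpace M] [ChartedSpace E M]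
    [IsManifold 𝓘(ℝ, E) ∞ M] [MeasurableSpace M] [BorelSpace M] {r : ℝ} {p : ℕ}
    (hp : packNumber M r ≤ p) :
    CoveringDimLE (AntiVRThickening M r) (((Module.finrank ℝ E : ℤ) + 1) * p - 1) := by
  have hsurj := weightedConfigurations.surjective_toThickening hp
  have : IsManifold 𝓘(ℝ, E) 1 M := .of_le (n := ∞) (by norm_cast)
  have : CompactSpace (weightedConfigurations M r p) :=
    isCompact_iff_compactSpace.1 (isCompact_weightedConfigurations M r p)
  have : CompactSpace (AntiVRThickening M r) := ⟨by
    rw [← hsurj.range_eq]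
    exact isCompact_range (weightedConfigurations.continuous_toThickening r p)⟩
  let A : Subalgebra ℝ C(AntiVRThickening M r, ℝ) :=
    { carrier := {φ | IsSmoothInCharts (E := E) p φ}
      mul_mem' := fun h h' ↦ h.mul h'
      add_mem' := fun h h' ↦ h.add h'
      algebraMap_mem' := fun c ↦ by
        have hc : ⇑(algebraMap ℝ C(AntiVRThickening M r, ℝ) c) = fun _ ↦ c :=
          funext fun μ ↦ by simp [algebraMap_apply]
        change IsSmoothInCharts p _
        rw [hc]
        exact .const c }
  have hA : A.SeparatesPoints := fun μ ν hne ↦ by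
    by_contra! h
    refine hne (Subtype.ext (MeasureTheory.Measure.ext_of_forall_contMDiff_integral_eq (E := E)
      fun g hg ↦ h _ ⟨⟨_, AntiVRThickening.continuous_integral r g⟩, ?_, rfl⟩))
    exact IsSmoothInCharts.integral hg
  have := coveringDimLE_of_separatesPoints A hA ((Module.finrank ℝ E + 1) * p) fun F hF ↦
    IsSmoothInCharts.dense_compl_range hp rfl (fun k ↦ F k) hF
  exact_mod_cast this

theorem theorem6p1 (n : ℕ) (M : Type*) [MetricSpace M] [CompactSpace M]
    [ChartedSpace (EuclideanSpace ℝ (Fin n)) M] [IsManifold (𝓡 n) ∞ M]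
    [Bundle.RiemannianBundle (fun x : M ↦ TangentSpace (𝓡 n) x)]
    [IsContMDiffRiemannianBundle (𝓡 n) ∞ (EuclideanSpace ℝ (Fin n))
      (fun x : M ↦ TangentSpace (𝓡 n) x)]
    (hM : IsRiemannianMetric (𝓡 n) M)
    [MeasurableSpace M] [BorelSpace M]
    (r : ℝ) (hr : 0 ≤ r) :
    (0 < r → packNumber M r ≠ ⊤) ∧
    ∀ p : ℕ, packNumber M r = p →
      CoveringDimLE (AntiVRThickening M r) (((n : ℤ) + 1) * (p : ℤ) - 1) := by
  refine ⟨packNumber_ne_top, fun p hp ↦ ?_⟩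
  have h := coveringDimLE_antiVRThickening (E := EuclideanSpace ℝ (Fin n)) hp.le
  rwa [finrank_euclideanSpace_fin] at h
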